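/- Let $\Omega\subset\mathbb R^d$ be open and bounded, let $N\ge 1$, and let $\Sigma_0,\dots,\Sigma_{N-1}\subset\mathbb R^d$ be bounded measurable sets (for instance all equal to one bounded open set $\Sigma$). Let $a_j:\Sigma_j\times\Omega\to\mathbb R$ be measurable kernels, $y_j\in L^1(\Sigma_j)$ with $y_j\ge 0$ a.e. ($0\le j\le N-1$), and put $$(A_jx)(s)=\int_\Omega a_j(s,t)\,x(t)\,dt,\qquad (A_j^*w)(t)=\int_{\Sigma_j}a_j(s,t)\,w(s)\,ds .$$ For nonnegative integrable functions $v,u$ on $D$ let $$d(v,u)=\int_D\Big[v\ln\frac vu-v+u\Big]\,dt\in[0,\infty]$$ be the Kullback–Leibler distance (with $0\ln\frac0u=0$ for $u\ge0$ and $v\ln\frac v0=\infty$ for $v>0$), where $D=\Omega$ or $D=\Sigma_j$, and let $f_j(x)=d(y_j,A_jx)$. Assume: (A1) $\int_{\Sigma_j}a_j(s,t)\,ds=1$ for a.e. $t\in\Omega$ and every $j$; (A2) there are constants $m,M>0$ with $m\le a_j(s,t)\le M$ for a.e. $(s,t)\in\Sigma_j\times\Omega$ and every $j$; (A3) $\int_{\Sigma_j}y_j\,ds=1$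 for every $j$, and there is $M'>0$ with $y_j\le M'$ a.e. in $\Sigma_j$ for every $j$. Let $x_0\in L^1(\Omega)$ with $x_0\ge0$ a.e. and $\int_\Omega x_0\,dt=1$, and let $(x_k)$ be generated by the OS-EM iteration $$x_{k+1}=x_k\,A_{[k]}^*\Big(\frac{y_{[k]}}{A_{[k]}x_k}\Big),\qquad [k]=k \bmod N .$$ Then: (i) $f_{[k]}(x_{k+1})\le f_{[k]}(x_k)$ for every $k\in\mathbb N$. Suppose in addition: (A4) $x^*\in L^1(\Omega)$ is nonnegative, is not a.e. equal to zero, satisfies $A_jx^*=y_j$ a.e. in $\Sigma_j$ for $j=0,\dots,N-1$, and $d(x^*,x_0)<\infty$. Then: (ii) the sequence $d(x^*,x_k)$ is nonincreasing; (iii) $\lim_{k\to\infty}f_{[k]}(x_k)=0$; (iv) $\lim_{k\to\infty}d(x_{k+1},x_k)=0$; (v) for each $0\le j\le N-1$ and each $p\in[1,\infty)$, $\lim_{n\to\infty}\|A_jx_{j+nN}-y_j\|_{L^p(\Sigma_j)}=0$; (vi) if $(x_k)$ is bounded in $L^p(\Omega)$ for some $p\in(1,\infty)$, then it has a subsequence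 that converges weakly in $L^p(\Omega)$ to some $z\in L^p(\Omega)$ solving the system, i.e. $A_jz=y_j$ a.e. in $\Sigma_j$ for $j=0,\dots,N-1$. -/

import Mathlib

open MeasureTheory Filter Topology
open scoped ENNReal NNReal

noncomputable section

namespace OSEM

/-- The ambient Euclidean space `ℝᵈ`. -/
abbrev Space (d : ℕ) : Type := EuclideanSpace ℝ (Fin d)

/-- The integrand `v ln (v / u) - v + u` of the Kullback-Leibler distance, with the usual
conventions `0 ln (0 / u) = 0` for `u ≥ 0` and `v ln (v / 0) = ∞` for `v > 0`; it is `∞` outside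
the domain `v, u ≥ 0`. -/
def klIntegrand (v u : ℝ) : ℝ≥0∞ :=
  open Classical in
  if 0 ≤ v ∧ 0 ≤ u ∧ (u = 0 → v = 0) then ENNReal.ofReal (v * Real.log (v / u) - v + u) else ∞

/-- On the domain the integrand is nonnegative, so `ENNReal.ofReal` above truncates nothing. -/
theorem klIntegrand_nonneg {v u : ℝ} (hv : 0 ≤ v) (hu : 0 ≤ u) (h : u = 0 → v = 0) :
    0 ≤ v * Real.log (v / u) - v + u := by
  rcases hu.eq_or_lt with rfl | hu'
  · simp [h rfl]
  rcases hv.eq_or_lt with rfl | hv'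
  · simpa using hu
  have h1 : Real.log (u / v) ≤ u / v - 1 := Real.log_le_sub_one_of_pos (by positivity)
  have h2 : Real.log (v / u) = - Real.log (u / v) := by
    rw [← Real.log_inv, inv_div]
  have h3 : v * Real.log (u / v) ≤ v * (u / v - 1) := mul_le_mul_of_nonneg_left h1 hv
  have h4 : v * (u / v - 1) = u - v := by field_simp
  rw [h2]
  linarith

/-- The Kullback-Leibler distance `d(v,u) = ∫_D [v ln (v / u) - v + u] dt`, with values in
`[0,∞]`. -/
def klDist {d : ℕ} (D : Set (Space d)) (v u : Space d → ℝ) : ℝ≥0∞ :=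
  ∫⁻ t in D, klIntegrand (v t) (u t)

/-- The set `Δ` of probability densities on `Ω`. -/
def IsDensity {d : ℕ} (Ω : Set (Space d)) (x : Space d → ℝ) : Prop :=
  Integrable x (volume.restrict Ω) ∧ (∀ᵐ t ∂(volume.restrict Ω), 0 ≤ x t) ∧ ∫ t in Ω, x t = 1

/-- The Fredholm integral operator `(A x)(s) = ∫_Ω a(s,t) x(t) dt`. -/
def fredholm {d : ℕ} (Ω : Set (Space d)) (a : Space d → Space d → ℝ) (x : Space d → ℝ) :
    Space d → ℝ :=
  fun s => ∫ t in Ω, a s t * x t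

/-- The adjoint operator `(A* w)(t) = ∫_S a(s,t) w(s) ds`. -/
def fredholmAdjoint {d : ℕ} (S : Set (Space d)) (a : Space d → Space d → ℝ) (w : Space d → ℝ) :
    Space d → ℝ :=
  fun t => ∫ s in S, a s t * w s

/-- The EM step `P(x) = x A*(y / (A x))` for one block. -/
def emStep {d : ℕ} (Ω S : Set (Space d)) (a : Space d → Space d → ℝ) (y x : Space d → ℝ) :
    Space d → ℝ :=
  fun t => x t * fredholmAdjoint S a (fun s => y s / fredholm Ω a x s) t

/-- The residual functional `f(x) = d(y, A x)` of one block. -/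
def residual {d : ℕ} (Ω S : Set (Space d)) (a : Space d → Space d → ℝ) (y x : Space d → ℝ) :
    ℝ≥0∞ :=
  klDist S y (fredholm Ω a x)

/-- The cyclic block index `[k] = k mod N`. -/
def blockIndex (N : ℕ) [NeZero N] (k : ℕ) : Fin N :=
  ⟨k % N, Nat.mod_lt k (Nat.pos_of_ne_zero (NeZero.ne N))⟩

/-- Assumption (A1): the (measurable) kernels satisfy `∫ a_j(s,t) ds = 1` for a.e. `t ∈ Ω`. -/
def AssumptionA1 {d N : ℕ} (Ω : Set (Space d)) (S : Fin N → Set (Space d))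
    (a : Fin N → Space d → Space d → ℝ) : Prop :=
  ∀ j, AEMeasurable (fun q : Space d × Space d => a j q.1 q.2)
      ((volume.restrict (S j)).prod (volume.restrict Ω)) ∧
    ∀ᵐ t ∂(volume.restrict Ω), ∫ s in S j, a j s t = 1

/-- Assumption (A2): the kernels are bounded above and bounded away from zero. -/
def AssumptionA2 {d N : ℕ} (Ω : Set (Space d)) (S : Fin N → Set (Space d))
    (a : Fin N → Space d → Space d → ℝ) : Prop :=
  ∃ m M : ℝ, 0 < m ∧ 0 < M ∧
    ∀ j, ∀ᵐ q ∂((volume.restrict (S j)).prod (volume.restrict Ω)),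
      m ≤ a j q.1 q.2 ∧ a j q.1 q.2 ≤ M

/-- Assumption (A3): the exact data are (nonnegative) densities, essentially bounded. -/
def AssumptionA3 {d N : ℕ} (S : Fin N → Set (Space d)) (y : Fin N → Space d → ℝ) : Prop :=
  (∀ j, IsDensity (S j) (y j)) ∧
    ∃ M' : ℝ, 0 < M' ∧ ∀ j, ∀ᵐ s ∂(volume.restrict (S j)), y j s ≤ M'

/-- `z ∈ L¹(Ω)` solves the system `A_j z = y_j`, `j = 0, …, N-1`. -/
def IsSolution {d N : ℕ} (Ω : Set (Space d)) (S : Fin N → Set (Space d))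
    (a : Fin N → Space d → Space d → ℝ) (y : Fin N → Space d → ℝ) (z : Space d → ℝ) : Prop :=
  Integrable z (volume.restrict Ω) ∧
    ∀ j, fredholm Ω (a j) z =ᵐ[volume.restrict (S j)] y j

/-- Assumption (A4) for the element `xs`: it is a nonnegative solution of the system, it is not
a.e. zero, and it has finite distance to the starting element `x0`. -/
def AssumptionA4 {d N : ℕ} (Ω : Set (Space d)) (S : Fin N → Set (Space d))
    (a : Fin N → Space d → Space d → ℝ) (y : Fin N → Space d → ℝ) (x0 xs : Space d → ℝ) : Prop :=
  IsSolution Ω S a y xs ∧ (∀ᵐ t ∂(volume.restrict Ω), 0 ≤ xs t) ∧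
    (¬ ∀ᵐ t ∂(volume.restrict Ω), xs t = 0) ∧ klDist Ω xs x0 < ∞

/-- `x` is a sequence generated by the OS-EM iteration `x_{k+1} = x_k A_{[k]}*(y_{[k]}/A_{[k]}x_k)`
(as an identity of classes of functions on `Ω`), started at some `x_0 ∈ Δ`. -/
def IsOSEMSequence {d N : ℕ} [NeZero N] (Ω : Set (Space d)) (S : Fin N → Set (Space d))
    (a : Fin N → Space d → Space d → ℝ) (y : Fin N → Space d → ℝ) (x : ℕ → Space d → ℝ) : Prop :=
  IsDensity Ω (x 0) ∧
    ∀ k, x (k + 1) =ᵐ[volume.restrict Ω]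
      emStep Ω (S (blockIndex N k)) (a (blockIndex N k)) (y (blockIndex N k)) (x k)

/-- The sequence `u` is bounded in `L^p(Ω)`. -/
def BoundedInLp {d : ℕ} (Ω : Set (Space d)) (p : ℝ≥0∞) (u : ℕ → Space d → ℝ) : Prop :=
  ∃ C : ℝ≥0, ∀ k, MemLp (u k) p (volume.restrict Ω) ∧ eLpNorm (u k) p (volume.restrict Ω) ≤ C

/-- Weak convergence `u_i ⇀ z` in `L^p(Ω)`, `1 < p < ∞`: all functions lie in `L^p(Ω)`, and
`∫_Ω u_i g → ∫_Ω z g` for every `g ∈ L^q(Ω)`, where `1/p + 1/q = 1`. -/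
def TendstoWeaklyLp {d : ℕ} (Ω : Set (Space d)) (p : ℝ≥0∞) (u : ℕ → Space d → ℝ)
    (z : Space d → ℝ) : Prop :=
  (∀ i, MemLp (u i) p (volume.restrict Ω)) ∧ MemLp z p (volume.restrict Ω) ∧
    ∀ (q : ℝ≥0∞), p.HolderConjugate q → ∀ g : Space d → ℝ, MemLp g q (volume.restrict Ω) →
      Tendsto (fun i => ∫ t in Ω, u i t * g t) atTop (𝓝 (∫ t in Ω, z t * g t))

end OSEM

end

/-!
One step `x ↦ x w` with `w = A*(y / A x)` is compared with two Kullback-Leibler distances. Since the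
kernel takes values in `[m, M]` with `m > 0` and its columns have mass one, `A` maps probability
densities to probability densities with values in `[m, M]`, and `w` takes values in
`[m / M, M / m]`. Hence every logarithm below is bounded, steps preserve probability densities, and
the linear terms of the distances cancel.

Jensen's inequality for the logarithm, with the probability densities `a(s,·) x / (A x)(s)` on `Ω`,
gives `f(x w) + d(x w, x) ≤ f(x)` (`IsBlockKernel.residual_emStep_add_le`). With the densities
`a(·,t)` on `Σ` it gives `f(x) + d(x*, x w) ≤ d(x*, x)` for a solution `x*`
(`IsBlockKernel.residual_add_klDist_emStep_le`); here `y = A x* ≥ m` keeps `log (y / A x)` bounded.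
The second inequality telescopes, so the residuals of the active blocks are summable and tend to
zero, and by the first one so do the distances `d(x_{k+1}, x_k)`.

The distance of two probability densities controls their difference in `L¹`
(`eLpNorm_one_sub_le`). On the images `A_j x_k`, which are bounded uniformly, `L¹` convergence is
`L^p` convergence. As consecutive iterates approach each other in `L¹` and every block recurs within
`N` steps, `A_j x_k → y_j` in `L¹` for every `j` along the whole sequence. A sequence bounded in
`L^p` has a weakly convergent subsequence (`exists_subseq_tendsto_integral_mul`): the functionals it
defines on the separable space `L^q` are weak-* sequentially compact, and a functional on `L^q` is
represented by a function in `L^p`, the Radon-Nikodym derivative of its values on indicators. Rows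
of the kernel are bounded, so `A_j` turns weak convergence into pointwise convergence, and the weak
limit solves the system because limits in measure are unique.
-/

namespace OSEM

/-! ### The Kullback-Leibler distance -/

theorem klIntegrand_eq_ofReal {v u : ℝ} (hv : 0 ≤ v) (hu : 0 ≤ u) (h : u = 0 → v = 0) :
    klIntegrand v u = ENNReal.ofReal (v * Real.log (v / u) - v + u) :=
  if_pos ⟨hv, hu, h⟩

theorem measurable_klIntegrand : Measurable fun q : ℝ × ℝ => klIntegrand q.1 q.2 := by
  classical
  have h0 : MeasurableSet {q : ℝ × ℝ | q.1 = 0} := measurable_fst (measurableSet_singleton 0)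
  have h1 : MeasurableSet {q : ℝ × ℝ | q.2 = 0} := measurable_snd (measurableSet_singleton 0)
  have h2 : MeasurableSet {q : ℝ × ℝ | 0 ≤ q.1 ∧ 0 ≤ q.2 ∧ (q.2 = 0 → q.1 = 0)} := by
    refine (measurableSet_le measurable_const measurable_fst).inter
      ((measurableSet_le measurable_const measurable_snd).inter ?_)
    have : {q : ℝ × ℝ | q.2 = 0 → q.1 = 0} = {q : ℝ × ℝ | q.2 = 0}ᶜ ∪ {q : ℝ × ℝ | q.1 = 0} := by
      ext q
      simp [imp_iff_not_or]
    change MeasurableSet {q : ℝ × ℝ | q.2 = 0 → q.1 = 0}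
    rw [this]
    exact h1.compl.union h0
  unfold klIntegrand
  refine Measurable.ite h2 ?_ measurable_const
  fun_prop

/-- The integrand dominates the squared Hellinger difference. This follows from
`log r ≤ r - 1` at `r = √(u / v)`. -/
theorem sq_sqrt_sub_sqrt_le_klIntegrand (v u : ℝ) :
    ENNReal.ofReal ((√v - √u) ^ 2) ≤ klIntegrand v u := by
  by_cases h : 0 ≤ v ∧ 0 ≤ u ∧ (u = 0 → v = 0)
  swap
  · simp [klIntegrand, h]
  obtain ⟨hv, hu, h⟩ := h
  rw [klIntegrand_eq_ofReal hv hu h]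
  refine ENNReal.ofReal_le_ofReal ?_
  rcases hu.eq_or_lt with rfl | hu'
  · simp [h rfl]
  rcases hv.eq_or_lt with rfl | hv'
  · simp [Real.sq_sqrt hu]
  have h1 : Real.log (√u / √v) ≤ √u / √v - 1 := Real.log_le_sub_one_of_pos (by positivity)
  have h2 : Real.log (v / u) = -2 * Real.log (√u / √v) := by
    rw [Real.log_div hv'.ne' hu'.ne', Real.log_div (by positivity) (by positivity),
      Real.log_sqrt hu, Real.log_sqrt hv]
    ring
  have h3 : v * (√u / √v) = √v * √u := by
    rw [mul_div_assoc', div_eq_iff (by positivity), mul_right_comm, Real.mul_self_sqrt hv]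
  have h4 : v * Real.log (√u / √v) ≤ v * (√u / √v - 1) := mul_le_mul_of_nonneg_left h1 hv
  rw [h2]
  nlinarith [Real.sq_sqrt hv, Real.sq_sqrt hu]

theorem klDist_congr {d : ℕ} {D : Set (Space d)} {v v' u u' : Space d → ℝ}
    (hv : v =ᵐ[volume.restrict D] v') (hu : u =ᵐ[volume.restrict D] u') :
    klDist D v u = klDist D v' u' := by
  refine lintegral_congr_ae ?_
  filter_upwards [hv, hu] with t h1 h2
  rw [h1, h2]

theorem norm_log_le {c C r : ℝ} (hc : 0 < c) (h : c ≤ r ∧ r ≤ C) :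
    ‖Real.log r‖ ≤ max |Real.log c| |Real.log C| :=
  abs_le_max_abs_abs (Real.log_le_log hc h.1) (Real.log_le_log (hc.trans_le h.1) h.2)

theorem norm_le_of_mem_Icc {c C r : ℝ} (hc : 0 < c) (h : c ≤ r ∧ r ≤ C) : ‖r‖ ≤ C := by
  rw [Real.norm_of_nonneg (hc.le.trans h.1)]
  exact h.2

theorem integrable_mul_log {α : Type*} [MeasurableSpace α] {μ : Measure α} {v r : α → ℝ}
    {c C : ℝ} (hc : 0 < c) (hv : Integrable v μ) (hr : AEStronglyMeasurable r μ)
    (hrb : ∀ᵐ t ∂μ, c ≤ r t ∧ r t ≤ C) : Integrable (fun t => v t * Real.log (r t)) μ :=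
  hv.mul_bdd (Real.measurable_log.comp_aemeasurable hr.aemeasurable).aestronglyMeasurable
    (hrb.mono fun _ h => norm_log_le hc h)

/-- For a bounded density `r` of `v = u r` with respect to `u` the distance is the relative
entropy: the linear terms cancel because the masses agree. -/
theorem klDist_mul_self {d : ℕ} {D : Set (Space d)} {u r : Space d → ℝ} {c C : ℝ} (hc : 0 < c)
    (hu : Integrable u (volume.restrict D)) (hu0 : ∀ᵐ t ∂(volume.restrict D), 0 ≤ u t)
    (hr : AEStronglyMeasurable r (volume.restrict D))
    (hrb : ∀ᵐ t ∂(volume.restrict D), c ≤ r t ∧ r t ≤ C)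
    (hm : ∫ t in D, u t * r t = ∫ t in D, u t) :
    klDist D (fun t => u t * r t) u = ENNReal.ofReal (∫ t in D, u t * r t * Real.log (r t)) ∧
      0 ≤ ∫ t in D, u t * r t * Real.log (r t) := by
  have hur : Integrable (fun t => u t * r t) (volume.restrict D) :=
    hu.mul_bdd hr (hrb.mono fun _ h => norm_le_of_mem_Icc hc h)
  have hl := integrable_mul_log hc hur hr hrb
  have hs : Integrable (fun t => u t * r t * Real.log (r t) - u t * r t) (volume.restrict D) :=
    hl.sub hur
  have key : ∀ᵐ t ∂(volume.restrict D),
      0 ≤ u t * r t * Real.log (r t) - u t * r t + u t ∧ klIntegrand (u t * r t) (u t) =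
        ENNReal.ofReal (u t * r t * Real.log (r t) - u t * r t + u t) := by
    filter_upwards [hu0, hrb] with t h0 hb
    have hv0 : 0 ≤ u t * r t := mul_nonneg h0 (hc.le.trans hb.1)
    have hz : u t = 0 → u t * r t = 0 := fun h => by simp [h]
    have e : u t * r t * Real.log (u t * r t / u t) = u t * r t * Real.log (r t) := by
      by_cases h : u t = 0
      · simp [h]
      · rw [mul_div_cancel_left₀ _ h]
    have h1 := klIntegrand_nonneg hv0 h0 hz
    rw [klIntegrand_eq_ofReal hv0 h0 hz]
    rw [e] at h1 ⊢
    exact ⟨h1, rfl⟩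
  have hi : Integrable (fun t => u t * r t * Real.log (r t) - u t * r t + u t)
    (volume.restrict D) := hs.add hu
  have e : ∫ t in D, (u t * r t * Real.log (r t) - u t * r t + u t) =
      ∫ t in D, u t * r t * Real.log (r t) := by
    rw [integral_add hs hu, integral_sub hl hur, hm]
    ring
  rw [← e]
  refine ⟨?_, integral_nonneg_of_ae (key.mono fun _ h => h.1)⟩
  rw [ofReal_integral_eq_lintegral_ofReal hi (key.mono fun _ h => h.1)]
  exact lintegral_congr_ae (key.mono fun _ h => h.2)

/-- Multiplying the reference function by `w` without changing its mass lowers the distance by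
`∫ v log w`. -/
theorem klDist_mul_right_add_le {d : ℕ} {D : Set (Space d)} {v u w : Space d → ℝ} {c C ρ : ℝ}
    (hc : 0 < c) (hv : Integrable v (volume.restrict D))
    (hu : Integrable u (volume.restrict D))
    (hw : AEStronglyMeasurable w (volume.restrict D))
    (hwb : ∀ᵐ t ∂(volume.restrict D), c ≤ w t ∧ w t ≤ C)
    (hm : ∫ t in D, u t * w t = ∫ t in D, u t) (hρ : 0 ≤ ρ)
    (h : ρ ≤ ∫ t in D, v t * Real.log (w t)) :
    ENNReal.ofReal ρ + klDist D v (fun t => u t * w t) ≤ klDist D v u := by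
  by_cases hfin : klDist D v u = ∞
  · simp [hfin]
  have hmeas : AEMeasurable (fun t => klIntegrand (v t) (u t)) (volume.restrict D) :=
    measurable_klIntegrand.comp_aemeasurable (hv.aemeasurable.prodMk hu.aemeasurable)
  -- Finiteness of the distance forces the domain conditions almost everywhere; in particular
  -- `v` vanishes where `u` does.
  have hdom : ∀ᵐ t ∂(volume.restrict D), 0 ≤ v t ∧ 0 ≤ u t ∧ (u t = 0 → v t = 0) := by
    filter_upwards [ae_lt_top' hmeas hfin] with t ht
    by_contra hn
    simp [klIntegrand, hn] at ht
  have hnn : 0 ≤ᵐ[volume.restrict D] fun t => v t * Real.log (v t / u t) - v t + u t :=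
    hdom.mono fun t h => klIntegrand_nonneg h.1 h.2.1 h.2.2
  have hK : klDist D v u =
      ∫⁻ t in D, ENNReal.ofReal (v t * Real.log (v t / u t) - v t + u t) :=
    lintegral_congr_ae (hdom.mono fun t h => klIntegrand_eq_ofReal h.1 h.2.1 h.2.2)
  have hKi : Integrable (fun t => v t * Real.log (v t / u t) - v t + u t)
      (volume.restrict D) := by
    refine (lintegral_ofReal_ne_top_iff_integrable ?_ hnn).1 (hK ▸ hfin)
    have := hv.aemeasurable
    have := hu.aemeasurable
    exact AEMeasurable.aestronglyMeasurable (by fun_prop)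
  have huw : Integrable (fun t => u t * w t) (volume.restrict D) :=
    hu.mul_bdd hw (hwb.mono fun _ h => norm_le_of_mem_Icc hc h)
  have hl := integrable_mul_log hc hv hw hwb
  have hs : Integrable (fun t => v t * Real.log (v t / u t) - v t + u t - v t * Real.log (w t))
      (volume.restrict D) := hKi.sub hl
  have hs' : Integrable (fun t => u t * w t - u t) (volume.restrict D) := huw.sub hu
  have key : ∀ᵐ t ∂(volume.restrict D),
      0 ≤ v t * Real.log (v t / u t) - v t + u t - v t * Real.log (w t) + (u t * w t - u t) ∧
      klIntegrand (v t) (u t * w t) = ENNReal.ofReal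
        (v t * Real.log (v t / u t) - v t + u t - v t * Real.log (w t) + (u t * w t - u t)) := by
    filter_upwards [hdom, hwb] with t ⟨hv0, hu0, hz⟩ hb
    have hw0 : 0 < w t := hc.trans_le hb.1
    have hz' : u t * w t = 0 → v t = 0 := fun h =>
      hz ((mul_eq_zero.1 h).resolve_right hw0.ne')
    have e : v t * Real.log (v t / (u t * w t)) - v t + u t * w t =
        v t * Real.log (v t / u t) - v t + u t - v t * Real.log (w t) + (u t * w t - u t) := by
      by_cases h : v t = 0
      · simp [h]
      · have hu' : u t ≠ 0 := fun h' => h (hz h')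
        rw [← div_div, Real.log_div (div_ne_zero h hu') hw0.ne']
        ring
    have h1 := klIntegrand_nonneg hv0 (mul_nonneg hu0 hw0.le) hz'
    rw [klIntegrand_eq_ofReal hv0 (mul_nonneg hu0 hw0.le) hz']
    rw [e] at h1 ⊢
    exact ⟨h1, rfl⟩
  have hi : Integrable (fun t => v t * Real.log (v t / u t) - v t + u t - v t * Real.log (w t) +
      (u t * w t - u t)) (volume.restrict D) := hs.add hs'
  have e : ∫ t in D, (v t * Real.log (v t / u t) - v t + u t - v t * Real.log (w t) +
      (u t * w t - u t)) = (∫ t in D, (v t * Real.log (v t / u t) - v t + u t)) -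
        ∫ t in D, v t * Real.log (w t) := by
    rw [integral_add hs hs', integral_sub hKi hl, integral_sub huw hu, hm]
    ring
  have e1 : klDist D v (fun t => u t * w t) = ENNReal.ofReal
      ((∫ t in D, (v t * Real.log (v t / u t) - v t + u t)) -
        ∫ t in D, v t * Real.log (w t)) := by
    rw [← e, ofReal_integral_eq_lintegral_ofReal hi (key.mono fun _ h => h.1)]
    exact lintegral_congr_ae (key.mono fun _ h => h.2)
  have e2 : 0 ≤ (∫ t in D, (v t * Real.log (v t / u t) - v t + u t)) -
        ∫ t in D, v t * Real.log (w t) := by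
    rw [← e]
    exact integral_nonneg_of_ae (key.mono fun _ h => h.1)
  rw [e1, hK, ← ofReal_integral_eq_lintegral_ofReal hKi hnn, ← ENNReal.ofReal_add hρ e2]
  exact ENNReal.ofReal_le_ofReal (by linarith)

/-- Jensen's inequality for the logarithm and a probability density `k`, obtained by integrating
the tangent line of `log` at the mean. -/
theorem integral_mul_log_le_log_integral_mul {α : Type*} [MeasurableSpace α] {μ : Measure α}
    {k r : α → ℝ} {c C : ℝ} (hc : 0 < c) (hk : Integrable k μ) (hk0 : ∀ᵐ t ∂μ, 0 ≤ k t)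
    (hk1 : ∫ t, k t ∂μ = 1) (hr : AEStronglyMeasurable r μ)
    (hrb : ∀ᵐ t ∂μ, c ≤ r t ∧ r t ≤ C) :
    ∫ t, k t * Real.log (r t) ∂μ ≤ Real.log (∫ t, k t * r t ∂μ) := by
  have hkr : Integrable (fun t => k t * r t) μ :=
    hk.mul_bdd hr (hrb.mono fun _ h => norm_le_of_mem_Icc hc h)
  have hpos : 0 < ∫ t, k t * r t ∂μ := by
    have : ∫ t, k t * c ∂μ ≤ ∫ t, k t * r t ∂μ := by
      refine integral_mono_ae (hk.mul_const c) hkr ?_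
      filter_upwards [hk0, hrb] with t h0 hb using mul_le_mul_of_nonneg_left hb.1 h0
    rw [integral_mul_const, hk1, one_mul] at this
    exact hc.trans_le this
  set W := ∫ t, k t * r t ∂μ
  have h1 : ∫ t, k t * Real.log (r t) ∂μ ≤
      ∫ t, (k t * (Real.log W - 1) + k t * r t * W⁻¹) ∂μ := by
    refine integral_mono_ae (integrable_mul_log hc hk hr hrb)
      ((hk.mul_const _).add (hkr.mul_const _)) ?_
    filter_upwards [hk0, hrb] with t h0 hb
    have hr0 : 0 < r t := hc.trans_le hb.1
    have h2 := Real.log_le_sub_one_of_pos (div_pos hr0 hpos)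
    rw [Real.log_div hr0.ne' hpos.ne'] at h2
    have h3 : k t * Real.log (r t) ≤ k t * (Real.log W - 1 + r t / W) :=
      mul_le_mul_of_nonneg_left (by linarith) h0
    refine h3.trans (le_of_eq ?_)
    rw [div_eq_mul_inv]
    ring
  rw [integral_add (hk.mul_const _) (hkr.mul_const _), integral_mul_const, integral_mul_const,
    hk1, mul_inv_cancel₀ hpos.ne'] at h1
  linarith

/-! ### Operators with a bounded Markov kernel -/

/-- A measurable kernel on `S × Ω` with values in `[m, M]`, where `0 < m`, all of whose columns
`a(·, t)` have mass one on `S`. -/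
structure IsBlockKernel {d : ℕ} (Ω S : Set (Space d)) (a : Space d → Space d → ℝ) (m M : ℝ) :
    Prop where
  pos : 0 < m
  pos' : 0 < M
  aemeasurable : AEMeasurable (fun q : Space d × Space d => a q.1 q.2)
    ((volume.restrict S).prod (volume.restrict Ω))
  bounds : ∀ᵐ q ∂((volume.restrict S).prod (volume.restrict Ω)), m ≤ a q.1 q.2 ∧ a q.1 q.2 ≤ M
  integral_eq_one : ∀ᵐ t ∂(volume.restrict Ω), ∫ s in S, a s t = 1

namespace IsBlockKernel

variable {d : ℕ} {Ω S : Set (Space d)} {a : Space d → Space d → ℝ} {m M : ℝ}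

theorem ae_row (h : IsBlockKernel Ω S a m M) :
    ∀ᵐ s ∂(volume.restrict S), AEStronglyMeasurable (a s) (volume.restrict Ω) ∧
      ∀ᵐ t ∂(volume.restrict Ω), m ≤ a s t ∧ a s t ≤ M :=
  h.aemeasurable.aestronglyMeasurable.prodMk_left.and (Measure.ae_ae_of_ae_prod h.bounds)

theorem ae_column (h : IsBlockKernel Ω S a m M) :
    ∀ᵐ t ∂(volume.restrict Ω),
      AEStronglyMeasurable (fun s => a s t) (volume.restrict S) ∧
      ∀ᵐ s ∂(volume.restrict S), m ≤ a s t ∧ a s t ≤ M :=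
  h.aemeasurable.aestronglyMeasurable.prodMk_right.and
    (Measure.ae_ae_of_ae_prod
      (Measure.measurePreserving_swap.quasiMeasurePreserving.ae h.bounds))

theorem aestronglyMeasurable_fredholm (h : IsBlockKernel Ω S a m M) {x : Space d → ℝ}
    (hx : Integrable x (volume.restrict Ω)) :
    AEStronglyMeasurable (fredholm Ω a x) (volume.restrict S) :=
  (h.aemeasurable.aestronglyMeasurable.mul hx.aestronglyMeasurable.comp_snd).integral_prod_right'

theorem aestronglyMeasurable_fredholmAdjoint (h : IsBlockKernel Ω S a m M) {r : Space d → ℝ}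
    (hr : Integrable r (volume.restrict S)) :
    AEStronglyMeasurable (fredholmAdjoint S a r) (volume.restrict Ω) :=
  (h.aemeasurable.aestronglyMeasurable.mul
    hr.aestronglyMeasurable.comp_fst).prod_swap.integral_prod_right'

theorem integrable_row_mul (h : IsBlockKernel Ω S a m M) {x : Space d → ℝ}
    (hx : Integrable x (volume.restrict Ω)) :
    ∀ᵐ s ∂(volume.restrict S), Integrable (fun t => a s t * x t) (volume.restrict Ω) := by
  filter_upwards [h.ae_row] with s hs
  exact hx.bdd_mul hs.1 (hs.2.mono fun _ hb => norm_le_of_mem_Icc h.pos hb)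

theorem integrable_column_mul (h : IsBlockKernel Ω S a m M) {r : Space d → ℝ}
    (hr : Integrable r (volume.restrict S)) :
    ∀ᵐ t ∂(volume.restrict Ω), Integrable (fun s => a s t * r s) (volume.restrict S) := by
  filter_upwards [h.ae_column] with t ht
  exact hr.bdd_mul ht.1 (ht.2.mono fun _ hb => norm_le_of_mem_Icc h.pos hb)

theorem integrable_prod (h : IsBlockKernel Ω S a m M) {x r : Space d → ℝ}
    (hx : Integrable x (volume.restrict Ω)) (hr : Integrable r (volume.restrict S)) :
    Integrable (fun q : Space d × Space d => a q.1 q.2 * x q.2 * r q.1)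
      ((volume.restrict S).prod (volume.restrict Ω)) := by
  refine ((hr.mul_prod hx).bdd_mul h.aemeasurable.aestronglyMeasurable
    (h.bounds.mono fun _ hb => norm_le_of_mem_Icc h.pos hb)).congr (.of_forall fun q => ?_)
  simp only
  ring

/-- The two integral operators are adjoint to each other. -/
theorem integral_fredholm_mul (h : IsBlockKernel Ω S a m M) {x r : Space d → ℝ}
    (hx : Integrable x (volume.restrict Ω)) (hr : Integrable r (volume.restrict S)) :
    ∫ s in S, fredholm Ω a x s * r s = ∫ t in Ω, x t * fredholmAdjoint S a r t := by
  have e := integral_integral_swap (f := fun s t => a s t * x t * r s) (h.integrable_prod hx hr)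
  unfold fredholm fredholmAdjoint
  have e' : ∀ s t, x t * (a s t * r s) = a s t * x t * r s := fun s t => by ring
  simp_rw [← integral_mul_const, ← integral_const_mul, e']
  exact e

theorem integrable_fredholm_mul (h : IsBlockKernel Ω S a m M) {x r : Space d → ℝ}
    (hx : Integrable x (volume.restrict Ω)) (hr : Integrable r (volume.restrict S)) :
    Integrable (fun s => fredholm Ω a x s * r s) (volume.restrict S) := by
  have e := (h.integrable_prod hx hr).integral_prod_left
  unfold fredholm
  simp_rw [← integral_mul_const]
  exact e

theorem integrable_fredholm [IsFiniteMeasure (volume.restrict S)] (h : IsBlockKernel Ω S a m M)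
    {x : Space d → ℝ} (hx : Integrable x (volume.restrict Ω)) :
    Integrable (fredholm Ω a x) (volume.restrict S) := by
  simpa using h.integrable_fredholm_mul hx (integrable_const (1 : ℝ))

/-- The operator preserves mass. -/
theorem integral_fredholm [IsFiniteMeasure (volume.restrict S)] (h : IsBlockKernel Ω S a m M)
    {x : Space d → ℝ} (hx : Integrable x (volume.restrict Ω)) :
    ∫ s in S, fredholm Ω a x s = ∫ t in Ω, x t := by
  have e := h.integral_fredholm_mul hx (integrable_const (1 : ℝ))
  simp only [mul_one] at e
  rw [e]
  refine integral_congr_ae ?_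
  filter_upwards [h.integral_eq_one] with t ht
  simp [fredholmAdjoint, ht]

/-- The image of a probability density inherits the bounds of the kernel. -/
theorem fredholm_bounds (h : IsBlockKernel Ω S a m M) {x : Space d → ℝ} (hx : IsDensity Ω x) :
    ∀ᵐ s ∂(volume.restrict S), m ≤ fredholm Ω a x s ∧ fredholm Ω a x s ≤ M := by
  filter_upwards [h.ae_row, h.integrable_row_mul hx.1] with s hs hi
  constructor
  · have : ∫ t in Ω, m * x t ≤ ∫ t in Ω, a s t * x t := by
      refine integral_mono_ae (hx.1.const_mul m) hi ?_
      filter_upwards [hs.2, hx.2.1] with t hb h0 using mul_le_mul_of_nonneg_right hb.1 h0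
    rwa [integral_const_mul, hx.2.2, mul_one] at this
  · have : ∫ t in Ω, a s t * x t ≤ ∫ t in Ω, M * x t := by
      refine integral_mono_ae hi (hx.1.const_mul M) ?_
      filter_upwards [hs.2, hx.2.1] with t hb h0 using mul_le_mul_of_nonneg_right hb.2 h0
    rwa [integral_const_mul, hx.2.2, mul_one] at this

theorem isDensity_fredholm [IsFiniteMeasure (volume.restrict S)] (h : IsBlockKernel Ω S a m M)
    {x : Space d → ℝ} (hx : IsDensity Ω x) : IsDensity S (fredholm Ω a x) :=
  ⟨h.integrable_fredholm hx.1, (h.fredholm_bounds hx).mono fun _ hb => h.pos.le.trans hb.1,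
    (h.integral_fredholm hx.1).trans hx.2.2⟩

/-! ### One step of the iteration -/

section Step

variable {x y : Space d → ℝ}

theorem integrable_ratio (h : IsBlockKernel Ω S a m M) (hx : IsDensity Ω x)
    (hy : IsDensity S y) :
    Integrable (fun s => y s / fredholm Ω a x s) (volume.restrict S) := by
  simp_rw [div_eq_mul_inv]
  refine hy.1.mul_bdd (c := m⁻¹)
    (h.aestronglyMeasurable_fredholm hx.1).aemeasurable.inv.aestronglyMeasurable ?_
  filter_upwards [h.fredholm_bounds hx] with s hs
  rw [norm_inv, Real.norm_of_nonneg (h.pos.le.trans hs.1)]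
  exact inv_anti₀ h.pos hs.1

/-- The multiplier of a step is bounded above and away from zero. -/
theorem multiplier_bounds (h : IsBlockKernel Ω S a m M) (hx : IsDensity Ω x)
    (hy : IsDensity S y) :
    ∀ᵐ t ∂(volume.restrict Ω),
      m / M ≤ fredholmAdjoint S a (fun s => y s / fredholm Ω a x s) t ∧
        fredholmAdjoint S a (fun s => y s / fredholm Ω a x s) t ≤ M / m := by
  have hr := h.integrable_ratio hx hy
  filter_upwards [h.ae_column, h.integrable_column_mul hr] with t ht hi
  constructor
  · have : ∫ s in S, m / M * y s ≤ ∫ s in S, a s t * (y s / fredholm Ω a x s) := by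
      refine integral_mono_ae (hy.1.const_mul _) hi ?_
      filter_upwards [ht.2, hy.2.1, h.fredholm_bounds hx] with s hb h0 hA
      rw [div_mul_eq_mul_div, mul_div_assoc]
      exact mul_le_mul hb.1 (div_le_div_of_nonneg_left h0 (h.pos.trans_le hA.1) hA.2)
        (div_nonneg h0 h.pos'.le) (h.pos.le.trans hb.1)
    rwa [integral_const_mul, hy.2.2, mul_one] at this
  · have : ∫ s in S, a s t * (y s / fredholm Ω a x s) ≤ ∫ s in S, M / m * y s := by
      refine integral_mono_ae hi (hy.1.const_mul _) ?_
      filter_upwards [ht.2, hy.2.1, h.fredholm_bounds hx] with s hb h0 hA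
      rw [div_mul_eq_mul_div, mul_div_assoc]
      exact mul_le_mul hb.2 (div_le_div_of_nonneg_left h0 h.pos hA.1)
        (div_nonneg h0 (h.pos.le.trans hA.1)) h.pos'.le
    rwa [integral_const_mul, hy.2.2, mul_one] at this

theorem integral_emStep (h : IsBlockKernel Ω S a m M) (hx : IsDensity Ω x)
    (hy : IsDensity S y) : ∫ t in Ω, emStep Ω S a y x t = 1 := by
  rw [← hy.2.2]
  refine (h.integral_fredholm_mul hx.1 (h.integrable_ratio hx hy)).symm.trans ?_
  refine integral_congr_ae ?_
  filter_upwards [h.fredholm_bounds hx] with s hs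
  exact mul_div_cancel₀ _ (h.pos.trans_le hs.1).ne'

theorem isDensity_emStep (h : IsBlockKernel Ω S a m M) (hx : IsDensity Ω x)
    (hy : IsDensity S y) : IsDensity Ω (emStep Ω S a y x) := by
  have hpos := div_pos h.pos h.pos'
  refine ⟨hx.1.mul_bdd (h.aestronglyMeasurable_fredholmAdjoint (h.integrable_ratio hx hy))
    ((h.multiplier_bounds hx hy).mono fun _ hb => norm_le_of_mem_Icc hpos hb), ?_,
    h.integral_emStep hx hy⟩
  filter_upwards [hx.2.1, h.multiplier_bounds hx hy] with t h0 hb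
  exact mul_nonneg h0 (hpos.le.trans hb.1)

/-- A step lowers the residual of its block at least by the distance between the iterates. By
Jensen's inequality for the probability densities `a(s,·) x / (A x)(s)`, the logarithm of
`A x' / A x` dominates the corresponding mean of `log (x' / x)`. -/
theorem residual_emStep_add_le [IsFiniteMeasure (volume.restrict S)]
    (h : IsBlockKernel Ω S a m M) (hx : IsDensity Ω x) (hy : IsDensity S y) :
    klDist Ω (emStep Ω S a y x) x + residual Ω S a y (emStep Ω S a y x) ≤
      residual Ω S a y x := by
  set w : Space d → ℝ := fredholmAdjoint S a (fun s => y s / fredholm Ω a x s) with hw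
  have hpos := div_pos h.pos h.pos'
  have hr := h.integrable_ratio hx hy
  have hwm : AEStronglyMeasurable w (volume.restrict Ω) :=
    h.aestronglyMeasurable_fredholmAdjoint hr
  have hwb := h.multiplier_bounds hx hy
  have hx' := h.isDensity_emStep hx hy
  have hA := h.fredholm_bounds hx
  have hA' := h.fredholm_bounds hx'
  have hAi := h.integrable_fredholm hx.1
  have hAi' := h.integrable_fredholm hx'.1
  obtain ⟨e1, e1'⟩ := klDist_mul_self hpos hx.1 hx.2.1 hwm hwb
    ((h.integral_emStep hx hy).trans hx.2.2.symm)
  set q : Space d → ℝ := fun s => fredholm Ω a (emStep Ω S a y x) s / fredholm Ω a x s with hq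
  have hqb : ∀ᵐ s ∂(volume.restrict S), m / M ≤ q s ∧ q s ≤ M / m := by
    filter_upwards [hA, hA'] with s h1 h2
    exact ⟨div_le_div₀ (h.pos.le.trans h2.1) h2.1 (h.pos.trans_le h1.1) h1.2,
      div_le_div₀ h.pos'.le h2.2 h.pos h1.1⟩
  have hqm : AEStronglyMeasurable q (volume.restrict S) :=
    (hAi'.aemeasurable.div hAi.aemeasurable).aestronglyMeasurable
  have hAq : (fun s => fredholm Ω a x s * q s) =ᵐ[volume.restrict S]
      fredholm Ω a (emStep Ω S a y x) := by
    filter_upwards [hA] with s h1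
    exact mul_div_cancel₀ _ (h.pos.trans_le h1.1).ne'
  have hmass : ∫ s in S, fredholm Ω a x s * q s = ∫ s in S, fredholm Ω a x s := by
    rw [integral_congr_ae hAq, h.integral_fredholm hx'.1, h.integral_fredholm hx.1, hx'.2.2,
      hx.2.2]
  have hxl : Integrable (fun t => x t * Real.log (w t)) (volume.restrict Ω) :=
    integrable_mul_log hpos hx.1 hwm hwb
  -- Jensen's inequality with the density `a(s,·) x / (A x)(s)`: the mean of `w` is `q(s)`.
  have jensen : ∀ᵐ s ∂(volume.restrict S),
      fredholm Ω a (fun t => x t * Real.log (w t)) s / fredholm Ω a x s ≤ Real.log (q s) := by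
    filter_upwards [hA, h.ae_row, h.integrable_row_mul hx.1] with s h1 h2 h3
    have hs0 : 0 < fredholm Ω a x s := h.pos.trans_le h1.1
    have hk1 : ∫ t in Ω, a s t * x t / fredholm Ω a x s = 1 := by
      rw [integral_div]
      exact div_self hs0.ne'
    have hk0 : ∀ᵐ t ∂(volume.restrict Ω), 0 ≤ a s t * x t / fredholm Ω a x s := by
      filter_upwards [h2.2, hx.2.1] with t hb h0
      exact div_nonneg (mul_nonneg (h.pos.le.trans hb.1) h0) hs0.le
    have hj := integral_mul_log_le_log_integral_mul hpos (h3.div_const _) hk0 hk1 hwm hwb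
    convert hj using 1
    · rw [fredholm, ← integral_div]
      refine integral_congr_ae (.of_forall fun t => ?_)
      simp only
      ring
    · congr 1
      simp only [hq]
      rw [fredholm, ← integral_div]
      refine integral_congr_ae (.of_forall fun t => ?_)
      simp only [emStep, ← hw]
      ring
  have key : ∫ t in Ω, x t * w t * Real.log (w t) ≤ ∫ s in S, y s * Real.log (q s) := by
    have e : ∫ t in Ω, x t * w t * Real.log (w t) =
        ∫ s in S, fredholm Ω a (fun t => x t * Real.log (w t)) s *
          (y s / fredholm Ω a x s) := by
      rw [h.integral_fredholm_mul hxl hr]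
      refine integral_congr_ae (.of_forall fun t => ?_)
      simp only [← hw]
      ring
    rw [e]
    refine integral_mono_ae (h.integrable_fredholm_mul hxl hr)
      (integrable_mul_log hpos hy.1 hqm hqb) ?_
    filter_upwards [jensen, hy.2.1] with s h1 h0
    calc _ = y s * (fredholm Ω a (fun t => x t * Real.log (w t)) s / fredholm Ω a x s) := by ring
      _ ≤ _ := mul_le_mul_of_nonneg_left h1 h0
  have main := klDist_mul_right_add_le hpos hy.1 hAi hqm hqb hmass e1' key
  rw [← e1, klDist_congr (ae_eq_refl y) hAq] at main
  exact main

/-- A step brings the iterate closer to any solution `xs`, at least by the residual of its block.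
The bounds on the kernel keep `y = A xs` away from zero, so `log (y / A x)` is bounded and
Jensen's inequality applies to the probability densities `a(·,t)`. -/
theorem residual_add_klDist_emStep_le [IsFiniteMeasure (volume.restrict S)]
    (h : IsBlockKernel Ω S a m M) (hx : IsDensity Ω x) (hy : IsDensity S y) {xs : Space d → ℝ}
    (hxs : IsDensity Ω xs) (hsol : fredholm Ω a xs =ᵐ[volume.restrict S] y) :
    residual Ω S a y x + klDist Ω xs (emStep Ω S a y x) ≤ klDist Ω xs x := by
  set r : Space d → ℝ := fun s => y s / fredholm Ω a x s with hrdef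
  set w : Space d → ℝ := fredholmAdjoint S a r with hw
  have hpos := div_pos h.pos h.pos'
  have hr : Integrable r (volume.restrict S) := h.integrable_ratio hx hy
  have hwm : AEStronglyMeasurable w (volume.restrict Ω) :=
    h.aestronglyMeasurable_fredholmAdjoint hr
  have hwb := h.multiplier_bounds hx hy
  have hA := h.fredholm_bounds hx
  have hAi := h.integrable_fredholm hx.1
  have hrb : ∀ᵐ s ∂(volume.restrict S), m / M ≤ r s ∧ r s ≤ M / m := by
    filter_upwards [hA, h.fredholm_bounds hxs, hsol] with s h1 h2 h3
    rw [h3] at h2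
    exact ⟨div_le_div₀ (h.pos.le.trans h2.1) h2.1 (h.pos.trans_le h1.1) h1.2,
      div_le_div₀ h.pos'.le h2.2 h.pos h1.1⟩
  have hAr : (fun s => fredholm Ω a x s * r s) =ᵐ[volume.restrict S] y := by
    filter_upwards [hA] with s h1
    exact mul_div_cancel₀ _ (h.pos.trans_le h1.1).ne'
  have hmass : ∫ s in S, fredholm Ω a x s * r s = ∫ s in S, fredholm Ω a x s := by
    rw [integral_congr_ae hAr, hy.2.2, h.integral_fredholm hx.1, hx.2.2]
  obtain ⟨e1, e1'⟩ := klDist_mul_self hpos hAi (h.isDensity_fredholm hx).2.1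
    hr.aestronglyMeasurable hrb hmass
  have hlr : Integrable (fun s => Real.log (r s)) (volume.restrict S) := by
    simpa using integrable_mul_log hpos (integrable_const (1 : ℝ)) hr.aestronglyMeasurable hrb
  have jensen : ∀ᵐ t ∂(volume.restrict Ω),
      fredholmAdjoint S a (fun s => Real.log (r s)) t ≤ Real.log (w t) := by
    filter_upwards [h.ae_column, h.integral_eq_one, h.integrable_column_mul
      (integrable_const (1 : ℝ))] with t h1 h2 h3
    simp only [mul_one] at h3
    exact integral_mul_log_le_log_integral_mul hpos h3
      (h1.2.mono fun _ hb => h.pos.le.trans hb.1) h2 hr.aestronglyMeasurable hrb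
  have key : ∫ s in S, fredholm Ω a x s * r s * Real.log (r s) ≤
      ∫ t in Ω, xs t * Real.log (w t) := by
    have e : ∫ s in S, fredholm Ω a x s * r s * Real.log (r s) =
        ∫ t in Ω, xs t * fredholmAdjoint S a (fun s => Real.log (r s)) t := by
      rw [← h.integral_fredholm_mul hxs.1 hlr]
      refine integral_congr_ae ?_
      filter_upwards [hAr, hsol] with s h1 h2
      rw [h1, h2]
    rw [e]
    refine integral_mono_ae ?_ (integrable_mul_log hpos hxs.1 hwm hwb) ?_
    · have := (h.integrable_prod hxs.1 hlr).integral_prod_right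
      unfold fredholmAdjoint
      have e' : ∀ s t, xs t * (a s t * Real.log (r s)) = a s t * xs t * Real.log (r s) :=
        fun s t => by ring
      simp_rw [← integral_const_mul, e']
      exact this
    · filter_upwards [jensen, hxs.2.1] with t h1 h0 using mul_le_mul_of_nonneg_left h1 h0
  have main := klDist_mul_right_add_le hpos hxs.1 hx.1 hwm hwb
    ((h.integral_emStep hx hy).trans hx.2.2.symm) e1' key
  rw [← e1, klDist_congr hAr (ae_eq_refl _)] at main
  exact main

end Step

end IsBlockKernel

/-! ### Weak sequential compactness of bounded sets in `L^p` -/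

section Duality

variable {α : Type*} [MeasurableSpace α] {μ : Measure α} [IsFiniteMeasure μ] {p q : ℝ≥0∞}

/-- The set function `s ↦ ℓ 1_s` of a continuous functional `ℓ` on `L^q` of a finite measure is
`σ`-additive. -/
noncomputable def signedMeasureOfDual [Fact (1 ≤ q)] (hq : q ≠ ∞) (ℓ : StrongDual ℝ (Lp ℝ q μ)) :
    SignedMeasure α := by
  classical
  refine
    { measureOf' := fun s => if hs : MeasurableSet s then
        ℓ (indicatorConstLp q hs (measure_ne_top μ s) 1) else 0
      empty' := by simp
      not_measurable' := fun s hs => dif_neg hs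
      m_iUnion' := fun f hf hd => ?_ }
  have hU : MeasurableSet (⋃ i, f i) := .iUnion hf
  have hF : ∀ F : Finset ℕ, MeasurableSet (⋃ i ∈ F, f i) := fun F =>
    F.measurableSet_biUnion fun i _ => hf i
  have hsum : ∀ F : Finset ℕ,
      ∑ i ∈ F, ℓ (indicatorConstLp q (hf i) (measure_ne_top μ (f i)) 1) =
        ℓ (indicatorConstLp q (hF F) (measure_ne_top μ _) 1) := by
    intro F
    induction F using Finset.induction_on with
    | empty => simp
    | insert i F hi ih =>
      have hdis : Disjoint (f i) (⋃ j ∈ F, f j) := by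
        simp only [Set.disjoint_iUnion_right]
        exact fun j hj => hd (fun e => hi (e ▸ hj))
      rw [Finset.sum_insert hi, ih, ← map_add, ← indicatorConstLp_disjoint_union (hf i) (hF F)
        (measure_ne_top μ _) (measure_ne_top μ _) hdis]
      congr 2
      simp
  -- The finite partial unions exhaust the union in measure, so their indicators converge in `L^q`.
  have hlim : Tendsto (fun F : Finset ℕ => μ (symmDiff (⋃ i ∈ F, f i) (⋃ i, f i))) atTop
      (𝓝 0) := by
    have h1 : ∀ F : Finset ℕ, μ (symmDiff (⋃ i ∈ F, f i) (⋃ i, f i)) =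
        μ (⋃ i, f i) - ∑ i ∈ F, μ (f i) := by
      intro F
      have hsub : (⋃ i ∈ F, f i) ⊆ ⋃ i, f i := Set.iUnion₂_subset fun i _ => Set.subset_iUnion f i
      rw [symmDiff_of_le hsub,
        measure_sdiff hsub (hF F).nullMeasurableSet (measure_ne_top μ _),
        measure_biUnion_finset (fun i _ j _ hij => hd hij) fun i _ => hf i]
    simp_rw [h1]
    have h2 : HasSum (fun i => μ (f i)) (μ (⋃ i, f i)) := by
      rw [measure_iUnion hd hf]
      exact ENNReal.summable.hasSum
    have h3 := ENNReal.Tendsto.sub (tendsto_const_nhds (x := μ (⋃ i, f i))) h2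
      (Or.inl (measure_ne_top μ _))
    rwa [tsub_self] at h3
  simp only [hf, hU, dif_pos]
  have := (ℓ.continuous.tendsto _).comp (tendsto_indicatorConstLp_set (c := (1 : ℝ)) (hs := hU)
    (hμs := measure_ne_top μ _) (ht := hF) (hμt := fun F => measure_ne_top μ _) hq hlim)
  rw [HasSum]
  refine this.congr fun F => ?_
  exact (hsum F).symm

theorem signedMeasureOfDual_apply [Fact (1 ≤ q)] (hq : q ≠ ∞) (ℓ : StrongDual ℝ (Lp ℝ q μ))
    {s : Set α} (hs : MeasurableSet s) :
    signedMeasureOfDual hq ℓ s = ℓ (indicatorConstLp q hs (measure_ne_top μ s) 1) :=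
  dif_pos hs

/-- A functional on `L^q` has an integrable density, the Radon-Nikodym derivative of its set
function, against which it integrates simple functions. -/
theorem exists_integrable_forall_simpleFunc [Fact (1 ≤ q)] (hq : q ≠ ∞)
    (ℓ : StrongDual ℝ (Lp ℝ q μ)) :
    ∃ z : α → ℝ, Measurable z ∧ Integrable z μ ∧
      ∀ (g : SimpleFunc α ℝ) (hg : MemLp g q μ), ℓ (hg.toLp g) = ∫ t, z t * g t ∂μ := by
  set σ := signedMeasureOfDual hq ℓ
  have hq0 : q ≠ 0 := (zero_lt_one.trans_le (Fact.out : 1 ≤ q)).ne'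
  have hac : σ ≪ᵥ μ.toENNRealVectorMeasure := by
    refine VectorMeasure.AbsolutelyContinuous.mk fun s hs h0 => ?_
    rw [Measure.toENNRealVectorMeasure_apply_measurable hs] at h0
    rw [signedMeasureOfDual_apply hq ℓ hs]
    have : indicatorConstLp q hs (measure_ne_top μ s) (1 : ℝ) = 0 := by
      rw [← norm_eq_zero, norm_indicatorConstLp hq0 hq, measureReal_def, h0]
      rw [ENNReal.toReal_zero,
        Real.zero_rpow (one_div_ne_zero (ENNReal.toReal_ne_zero.2 ⟨hq0, hq⟩)), mul_zero]
    rw [this, map_zero]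
  have hz : Integrable (σ.rnDeriv μ) μ := SignedMeasure.integrable_rnDeriv _ _
  refine ⟨σ.rnDeriv μ, SignedMeasure.measurable_rnDeriv _ _, hz, fun g => ?_⟩
  have hset : ∀ s, (hs : MeasurableSet s) →
      ℓ (indicatorConstLp q hs (measure_ne_top μ s) 1) = ∫ t in s, σ.rnDeriv μ t ∂μ := by
    intro s hs
    rw [← signedMeasureOfDual_apply hq ℓ hs, ← withDensityᵥ_apply hz hs,
      SignedMeasure.withDensityᵥ_rnDeriv_eq σ μ hac]
  have hint : ∀ g : SimpleFunc α ℝ, Integrable (fun t => σ.rnDeriv μ t * g t) μ := by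
    intro g
    obtain ⟨C, hC⟩ := g.exists_forall_norm_le
    exact hz.mul_bdd g.stronglyMeasurable.aestronglyMeasurable (.of_forall hC)
  induction g using SimpleFunc.induction with
  | const c hs =>
    intro hg
    rename_i s
    have e1 : hg.toLp _ = c • indicatorConstLp q hs (measure_ne_top μ s) (1 : ℝ) := by
      refine Lp.ext ?_
      filter_upwards [hg.coeFn_toLp,
        Lp.coeFn_smul c (indicatorConstLp q hs (measure_ne_top μ s) (1 : ℝ)),
        indicatorConstLp_coeFn (p := q) (hs := hs) (hμs := measure_ne_top μ s) (c := (1 : ℝ))]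
        with t h1 h2 h3
      rw [h1, h2, Pi.smul_apply, h3]
      by_cases ht : t ∈ s <;> simp [ht]
    rw [e1, map_smul, hset s hs, smul_eq_mul, ← integral_const_mul, ← integral_indicator hs]
    refine integral_congr_ae (.of_forall fun t => ?_)
    by_cases ht : t ∈ s <;> simp [ht, mul_comm]
  | add hfg hf hg =>
    rename_i f g
    intro hfg'
    have hf' : MemLp f q μ := SimpleFunc.memLp_of_isFiniteMeasure f q μ
    have hg' : MemLp g q μ := SimpleFunc.memLp_of_isFiniteMeasure g q μ
    have e1 : hfg'.toLp _ = hf'.toLp f + hg'.toLp g := MemLp.toLp_add hf' hg'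
    rw [e1, map_add, hf hf', hg hg', ← integral_add (hint f) (hint g)]
    refine integral_congr_ae (.of_forall fun t => ?_)
    simp [mul_add]

/-- The positive part of `z` lies in `L^p` if `z` acts boundedly, in the norm of the conjugate
space `L^q`, on nonnegative simple functions. The test functions are `ψ ^ (p - 1)` for simple
`ψ` increasing to the positive part. -/
theorem memLp_posPart_of_simpleFunc_bound [p.HolderConjugate q] (hp : p ≠ ∞) (hq : q ≠ ∞)
    {z : α → ℝ} (hzm : Measurable z) (hzi : Integrable z μ) {C : ℝ} (hC : 0 ≤ C)
    (h : ∀ g : SimpleFunc α ℝ, ∫ t, z t * g t ∂μ ≤ C * (eLpNorm g q μ).toReal) :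
    MemLp (fun t => max (z t) 0) p μ := by
  have hPQ : p.toReal.HolderConjugate q.toReal := ENNReal.HolderConjugate.toReal_of_ne_top hp hq
  have hp0 : p ≠ 0 := ENNReal.HolderConjugate.ne_zero p q
  have hq0 : q ≠ 0 := ENNReal.HolderConjugate.ne_zero q p
  set P := p.toReal
  set Q := q.toReal
  have hfm : Measurable fun t => ENNReal.ofReal (z t) := hzm.ennreal_ofReal
  set φ : ℕ → SimpleFunc α ℝ≥0∞ := SimpleFunc.eapprox fun t => ENNReal.ofReal (z t)
  have hbound : ∀ n, ∫⁻ t, φ n t ^ P ∂μ ≤ ENNReal.ofReal (C ^ P) := by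
    intro n
    set ψ : SimpleFunc α ℝ := (φ n).map ENNReal.toReal with hψ
    have hφtop : ∀ t, φ n t ≠ ∞ := fun t => (SimpleFunc.eapprox_lt_top _ n t).ne
    have hφle : ∀ t, φ n t ≤ ENNReal.ofReal (z t) := fun t => by
      rw [← SimpleFunc.iSup_eapprox_apply hfm t]
      exact le_iSup (fun n => φ n t) n
    have hψ0 : ∀ t, 0 ≤ ψ t := fun t => ENNReal.toReal_nonneg
    have hψle : ∀ t, ψ t ≤ max (z t) 0 := fun t => by
      have := ENNReal.toReal_mono ENNReal.ofReal_ne_top (hφle t)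
      rwa [ENNReal.toReal_ofReal'] at this
    set g : SimpleFunc α ℝ := ψ.map fun r => r ^ (P - 1) with hg
    have hψP : Integrable (fun t => ψ t ^ P) μ :=
      SimpleFunc.integrable_of_isFiniteMeasure (ψ.map fun r => r ^ P)
    have hzg : Integrable (fun t => z t * g t) μ := by
      obtain ⟨c, hc⟩ := g.exists_forall_norm_le
      exact hzi.mul_bdd g.stronglyMeasurable.aestronglyMeasurable (.of_forall hc)
    -- Since `(p - 1) q = p`, the `L^q` norm of `ψ ^ (p - 1)` is a power of `∫ ψ ^ p`.
    have hnorm : (eLpNorm g q μ).toReal = (∫ t, ψ t ^ P ∂μ) ^ (1 / Q) := by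
      have e : ∀ t, ‖g t‖ₑ ^ Q = ENNReal.ofReal (ψ t ^ P) := fun t => by
        have hg0 : 0 ≤ g t := Real.rpow_nonneg (hψ0 t) _
        rw [Real.enorm_of_nonneg hg0, ENNReal.ofReal_rpow_of_nonneg hg0 hPQ.symm.nonneg]
        congr 1
        simp only [hg, SimpleFunc.map_apply]
        rw [← Real.rpow_mul (hψ0 t), hPQ.sub_one_mul_conj]
      rw [eLpNorm_eq_lintegral_rpow_enorm_toReal hq0 hq]
      simp_rw [← show Q = q.toReal from rfl, e]
      rw [← ofReal_integral_eq_lintegral_ofReal hψP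
        (.of_forall fun t => Real.rpow_nonneg (hψ0 t) _), ← ENNReal.toReal_rpow,
        ENNReal.toReal_ofReal (integral_nonneg fun t => Real.rpow_nonneg (hψ0 t) _)]
    -- Where `z` is negative, `ψ` vanishes, so only the positive part of `z` is tested.
    have hle : ∫ t, ψ t ^ P ∂μ ≤ ∫ t, z t * g t ∂μ := by
      refine integral_mono hψP hzg fun t => ?_
      simp only [hg, SimpleFunc.map_apply]
      rcases (hψ0 t).eq_or_lt with h0 | h0
      · rw [← h0, Real.zero_rpow hPQ.ne_zero, Real.zero_rpow hPQ.sub_one_ne_zero, mul_zero]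
      · have hz : ψ t ≤ z t := by
          rcases le_max_iff.1 (hψle t) with h | h
          · exact h
          · exact absurd h0 h.not_gt
        calc ψ t ^ P = ψ t * ψ t ^ (P - 1) := by
              rw [← Real.rpow_one_add' h0.le (by simpa using hPQ.ne_zero)]
              congr 1
              ring
          _ ≤ _ := mul_le_mul_of_nonneg_right hz (Real.rpow_nonneg h0.le _)
    have hI0 : 0 ≤ ∫ t, ψ t ^ P ∂μ := integral_nonneg fun t => Real.rpow_nonneg (hψ0 t) _
    have hI : ∫ t, ψ t ^ P ∂μ ≤ C ^ P := by
      have h1 := hle.trans (h g)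
      rw [hnorm] at h1
      rcases hI0.eq_or_lt with h0 | h0
      · rw [← h0]
        exact Real.rpow_nonneg hC _
      · set I := ∫ t, ψ t ^ P ∂μ
        have h2 : I = I ^ (1 / P) * I ^ (1 / Q) := by
          rw [← Real.rpow_add h0, hPQ.one_div_add_one_div, div_one, Real.rpow_one]
        have h3 : I ^ (1 / P) ≤ C := by
          refine le_of_mul_le_mul_right ?_ (Real.rpow_pos_of_pos h0 (1 / Q))
          rw [← h2]
          exact h1
        calc I = (I ^ (1 / P)) ^ P := by
              rw [← Real.rpow_mul hI0, one_div_mul_cancel hPQ.ne_zero, Real.rpow_one]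
          _ ≤ C ^ P := Real.rpow_le_rpow (Real.rpow_nonneg hI0 _) h3 hPQ.nonneg
    have e : ∀ t, φ n t ^ P = ENNReal.ofReal (ψ t ^ P) := fun t => by
      rw [← ENNReal.ofReal_rpow_of_nonneg (hψ0 t) hPQ.nonneg]
      congr 1
      exact (ENNReal.ofReal_toReal (hφtop t)).symm
    simp_rw [e]
    rw [← ofReal_integral_eq_lintegral_ofReal hψP
      (.of_forall fun t => Real.rpow_nonneg (hψ0 t) _)]
    exact ENNReal.ofReal_le_ofReal hI
  have hlim : Tendsto (fun n => ∫⁻ t, φ n t ^ P ∂μ) atTop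
      (𝓝 (∫⁻ t, ENNReal.ofReal (z t) ^ P ∂μ)) := by
    refine lintegral_tendsto_of_tendsto_of_monotone
      (fun n => ((φ n).measurable.pow_const P).aemeasurable) ?_ ?_
    · exact .of_forall fun t i j hij =>
        ENNReal.rpow_le_rpow (SimpleFunc.monotone_eapprox _ hij t) hPQ.nonneg
    · exact .of_forall fun t => (ENNReal.continuous_rpow_const.tendsto _).comp
        (SimpleFunc.tendsto_eapprox hfm t)
  refine ⟨(hzm.max measurable_const).aestronglyMeasurable, ?_⟩
  rw [eLpNorm_lt_top_iff_lintegral_rpow_enorm_lt_top hp0 hp]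
  have e : ∀ t, ‖max (z t) 0‖ₑ = ENNReal.ofReal (z t) := fun t => by
    rw [Real.enorm_of_nonneg (le_max_right _ _), ENNReal.ofReal, ENNReal.ofReal, Real.toNNReal,
      Real.toNNReal]
    congr 1
    ext
    simp
  simp_rw [e]
  exact (le_of_tendsto' hlim hbound).trans_lt ENNReal.ofReal_lt_top

/-- The Riesz representation of functionals on `L^q` of a finite measure, `1 < q < ∞`. -/
theorem exists_memLp_forall_eq_integral [p.HolderConjugate q] [Fact (1 ≤ q)] (hp : p ≠ ∞)
    (hq : q ≠ ∞) (ℓ : StrongDual ℝ (Lp ℝ q μ)) :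
    ∃ z : α → ℝ, MemLp z p μ ∧ ∀ g : Lp ℝ q μ, ℓ g = ∫ t, z t * g t ∂μ := by
  obtain ⟨z, hzm, hzi, hz⟩ := exists_integrable_forall_simpleFunc hq ℓ
  have hb : ∀ g : SimpleFunc α ℝ, |∫ t, z t * g t ∂μ| ≤ ‖ℓ‖ * (eLpNorm g q μ).toReal := by
    intro g
    have hg : MemLp g q μ := SimpleFunc.memLp_of_isFiniteMeasure g q μ
    rw [← hz g hg, ← Lp.norm_toLp g hg]
    exact ℓ.le_opNorm _
  have h1 : MemLp (fun t => max (z t) 0) p μ :=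
    memLp_posPart_of_simpleFunc_bound hp hq hzm hzi (norm_nonneg ℓ)
      fun g => (le_abs_self _).trans (hb g)
  have h2 : MemLp (fun t => max (-z t) 0) p μ := by
    refine memLp_posPart_of_simpleFunc_bound hp hq hzm.neg hzi.neg (norm_nonneg ℓ) fun g => ?_
    simp only [neg_mul, integral_neg]
    exact (neg_le_abs _).trans (hb g)
  have hzp : MemLp z p μ := by
    have e : z = (fun t => max (z t) 0) - fun t => max (-z t) 0 := by
      ext t
      exact (max_zero_sub_max_neg_zero_eq_self (z t)).symm
    rw [e]
    exact h1.sub h2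
  refine ⟨z, hzp, fun g => ?_⟩
  have : Fact (1 ≤ p) := ⟨ENNReal.HolderConjugate.one_le p q⟩
  -- Pairing with `z` is now continuous on `L^q`, so it suffices to compare with `ℓ` on the dense
  -- set of simple functions.
  set T : StrongDual ℝ (Lp ℝ q μ) :=
    (ContinuousLinearMap.mul ℝ ℝ).lpPairing μ p q (hzp.toLp z) with hT
  have hTe : ∀ g : Lp ℝ q μ, T g = ∫ t, z t * g t ∂μ := by
    intro g
    rw [hT, ContinuousLinearMap.lpPairing_eq_integral]
    refine integral_congr_ae ?_
    filter_upwards [hzp.coeFn_toLp] with t ht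
    rw [ht]
    rfl
  rw [← hTe]
  refine (Lp.simpleFunc.denseRange hq).induction_on g
    (isClosed_eq ℓ.continuous T.continuous) fun f => ?_
  have hf : MemLp (Lp.simpleFunc.toSimpleFunc f) q μ := SimpleFunc.memLp_of_isFiniteMeasure _ q μ
  have e : (f : Lp ℝ q μ) = hf.toLp _ :=
    congrArg Subtype.val (Lp.simpleFunc.toLp_toSimpleFunc f).symm
  rw [hTe, e, hz _ hf]
  refine integral_congr_ae ?_
  filter_upwards [hf.coeFn_toLp] with t ht
  rw [ht]

/-- A bounded sequence in `L^p`, `1 < p < ∞`, has a weakly convergent subsequence: it is a bounded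
sequence of functionals on the separable space `L^q`. -/
theorem exists_subseq_tendsto_integral_mul [IsSeparable μ] [p.HolderConjugate q]
    (hp : p ≠ ∞) (hq : q ≠ ∞) {u : ℕ → α → ℝ} {C : ℝ≥0}
    (hu : ∀ k, MemLp (u k) p μ ∧ eLpNorm (u k) p μ ≤ C) :
    ∃ (φ : ℕ → ℕ) (z : α → ℝ), StrictMono φ ∧ MemLp z p μ ∧ ∀ g : α → ℝ, MemLp g q μ →
      Tendsto (fun i => ∫ t, u (φ i) t * g t ∂μ) atTop (𝓝 (∫ t, z t * g t ∂μ)) := by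
  have : Fact (1 ≤ p) := ⟨ENNReal.HolderConjugate.one_le p q⟩
  have : Fact (1 ≤ q) := ⟨ENNReal.HolderConjugate.one_le q p⟩
  have : Fact (q ≠ ∞) := ⟨hq⟩
  set B := (ContinuousLinearMap.mul ℝ ℝ).lpPairing μ p q
  set ℓ : ℕ → WeakDual ℝ (Lp ℝ q μ) := fun k =>
    StrongDual.toWeakDual (B ((hu k).1.toLp (u k))) with hℓ
  have hmem : ∀ k, ℓ k ∈ WeakDual.toStrongDual ⁻¹'
      Metric.closedBall (0 : StrongDual ℝ (Lp ℝ q μ)) (‖B‖ * C) := by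
    intro k
    rw [Set.mem_preimage, mem_closedBall_zero_iff]
    refine (B.le_opNorm _).trans (mul_le_mul_of_nonneg_left ?_ (norm_nonneg _))
    rw [Lp.norm_toLp]
    exact ENNReal.toReal_le_of_le_ofReal C.2 (by simpa using (hu k).2)
  obtain ⟨L, -, φ, hφ, hL⟩ := WeakDual.isSeqCompact_closedBall ℝ (Lp ℝ q μ) 0 (‖B‖ * C) hmem
  obtain ⟨z, hz, hzL⟩ := exists_memLp_forall_eq_integral hp hq (WeakDual.toStrongDual L)
  refine ⟨φ, z, hφ, hz, fun g hg => ?_⟩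
  have h1 : Tendsto (fun i => ℓ (φ i) (hg.toLp g)) atTop (𝓝 (L (hg.toLp g))) :=
    ((WeakDual.eval_continuous (hg.toLp g)).tendsto L).comp hL
  have h2 : L (hg.toLp g) = ∫ t, z t * g t ∂μ := by
    refine (hzL (hg.toLp g)).trans (integral_congr_ae ?_)
    filter_upwards [hg.coeFn_toLp] with t ht
    rw [ht]
  rw [h2] at h1
  refine h1.congr fun i => ?_
  refine (ContinuousLinearMap.lpPairing_eq_integral _ _ _).trans (integral_congr_ae ?_)
  filter_upwards [hg.coeFn_toLp, (hu (φ i)).1.coeFn_toLp] with t h3 h4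
  rw [h3, h4]
  rfl

end Duality

/-! ### Norm estimates from the distance -/

/-- A Pinsker type inequality: Cauchy-Schwarz applied to
`v - u = (√v - √u) (√v + √u)`. -/
theorem eLpNorm_one_sub_le {d : ℕ} {D : Set (Space d)} {v u : Space d → ℝ}
    (hv : IsDensity D v) (hu : IsDensity D u) :
    eLpNorm (fun t => v t - u t) 1 (volume.restrict D) ≤
      klDist D v u ^ (1 / 2 : ℝ) * ENNReal.ofReal 4 ^ (1 / 2 : ℝ) := by
  have hvm := hv.1.aemeasurable
  have hum := hu.1.aemeasurable
  set f : Space d → ℝ≥0∞ := fun t => ENNReal.ofReal |√(v t) - √(u t)| with hf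
  set g : Space d → ℝ≥0∞ := fun t => ENNReal.ofReal (√(v t) + √(u t)) with hg
  have e : eLpNorm (fun t => v t - u t) 1 (volume.restrict D) = ∫⁻ t in D, (f * g) t := by
    rw [eLpNorm_one_eq_lintegral_enorm]
    refine lintegral_congr_ae ?_
    filter_upwards [hv.2.1, hu.2.1] with t h1 h2
    have h3 : 0 ≤ √(v t) + √(u t) := by positivity
    rw [Pi.mul_apply, hf, hg]
    simp only
    rw [← ENNReal.ofReal_mul (abs_nonneg _), Real.enorm_eq_ofReal_abs]
    congr 1
    rw [← abs_of_nonneg h3, ← abs_mul]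
    congr 1
    nlinarith [Real.sq_sqrt h1, Real.sq_sqrt h2]
  have hfl : ∫⁻ t in D, f t ^ (2 : ℝ) ≤ klDist D v u := by
    refine lintegral_mono fun t => ?_
    simp only [hf]
    rw [ENNReal.ofReal_rpow_of_nonneg (abs_nonneg _) zero_le_two, Real.rpow_two, sq_abs]
    exact sq_sqrt_sub_sqrt_le_klIntegrand _ _
  have hgl : ∫⁻ t in D, g t ^ (2 : ℝ) ≤ ENNReal.ofReal 4 := by
    have hi : Integrable (fun t => 2 * (v t + u t)) (volume.restrict D) :=
      (hv.1.add hu.1).const_mul 2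
    have h4 : ∫ t in D, 2 * (v t + u t) = 4 := by
      rw [integral_const_mul, integral_add hv.1 hu.1, hv.2.2, hu.2.2]
      norm_num
    rw [← h4, ofReal_integral_eq_lintegral_ofReal hi]
    · refine lintegral_mono_ae ?_
      filter_upwards [hv.2.1, hu.2.1] with t h1 h2
      simp only [hg]
      rw [ENNReal.ofReal_rpow_of_nonneg (by positivity) zero_le_two, Real.rpow_two]
      refine ENNReal.ofReal_le_ofReal ?_
      nlinarith [Real.sq_sqrt h1, Real.sq_sqrt h2, sq_nonneg (√(v t) - √(u t))]
    · filter_upwards [hv.2.1, hu.2.1] with t h1 h2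
      simp only [Pi.zero_apply]
      positivity
  rw [e]
  refine (ENNReal.lintegral_mul_le_Lp_mul_Lq (volume.restrict D) Real.HolderConjugate.two_two
    (by fun_prop) (by fun_prop)).trans ?_
  gcongr

theorem tendsto_eLpNorm_one_sub {d : ℕ} {D : ℕ → Set (Space d)} {v u : ℕ → Space d → ℝ}
    (hv : ∀ n, IsDensity (D n) (v n)) (hu : ∀ n, IsDensity (D n) (u n))
    (h : Tendsto (fun n => klDist (D n) (v n) (u n)) atTop (𝓝 0)) :
    Tendsto (fun n => eLpNorm (fun t => v n t - u n t) 1 (volume.restrict (D n))) atTop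
      (𝓝 0) := by
  have h1 := ((ENNReal.continuous_rpow_const (y := 1 / 2)).tendsto 0).comp h
  have h2 := ENNReal.Tendsto.mul_const (b := ENNReal.ofReal 4 ^ (1 / 2 : ℝ)) h1
    (Or.inr (by simp))
  rw [ENNReal.zero_rpow_of_pos (by norm_num), zero_mul] at h2
  exact tendsto_of_tendsto_of_tendsto_of_le_of_le tendsto_const_nhds h2 (fun _ => zero_le)
    fun n => eLpNorm_one_sub_le (hv n) (hu n)

/-- For uniformly bounded functions convergence to zero in `L¹` implies it in `L^p`. -/
theorem tendsto_eLpNorm_of_bounded {α : Type*} [MeasurableSpace α] {μ : Measure α}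
    {f : ℕ → α → ℝ} {B : ℝ≥0} (hB : ∀ n, ∀ᵐ t ∂μ, ‖f n t‖ₑ ≤ B) {p : ℝ≥0∞} (hp1 : 1 ≤ p)
    (hp : p ≠ ∞) (h : Tendsto (fun n => eLpNorm (f n) 1 μ) atTop (𝓝 0)) :
    Tendsto (fun n => eLpNorm (f n) p μ) atTop (𝓝 0) := by
  have hp0 : p ≠ 0 := (zero_lt_one.trans_le hp1).ne'
  have hP : 1 ≤ p.toReal := by simpa using ENNReal.toReal_mono hp hp1
  set P := p.toReal with hPdef
  have hP0 : 0 < P := zero_lt_one.trans_le hP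
  have hle : ∀ n, eLpNorm (f n) p μ ≤ ((B : ℝ≥0∞) ^ (P - 1) * eLpNorm (f n) 1 μ) ^ (1 / P) := by
    intro n
    rw [eLpNorm_eq_lintegral_rpow_enorm_toReal hp0 hp, eLpNorm_one_eq_lintegral_enorm,
      ← lintegral_const_mul' _ _ (ENNReal.rpow_ne_top_of_nonneg (by linarith) ENNReal.coe_ne_top)]
    refine ENNReal.rpow_le_rpow (lintegral_mono_ae ?_) (by positivity)
    filter_upwards [hB n] with t ht
    calc ‖f n t‖ₑ ^ P = ‖f n t‖ₑ ^ (P - 1) * ‖f n t‖ₑ := by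
          conv_rhs => rw [← ENNReal.rpow_one (‖f n t‖ₑ), ← ENNReal.rpow_mul]
          rw [← ENNReal.rpow_add_of_nonneg _ _ (by linarith) zero_le_one]
          congr 1
          ring
      _ ≤ _ := by gcongr
  have h1 := ENNReal.Tendsto.const_mul (a := (B : ℝ≥0∞) ^ (P - 1)) h
    (Or.inr (ENNReal.rpow_ne_top_of_nonneg (by linarith) ENNReal.coe_ne_top))
  have h2 := ((ENNReal.continuous_rpow_const (y := 1 / P)).tendsto _).comp h1
  rw [mul_zero, ENNReal.zero_rpow_of_pos (by positivity)] at h2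
  exact tendsto_of_tendsto_of_tendsto_of_le_of_le tendsto_const_nhds h2 (fun _ => zero_le) hle

/-- The operator is a contraction in `L¹`. -/
theorem IsBlockKernel.eLpNorm_fredholm_sub_le {d : ℕ} {Ω S : Set (Space d)}
    {a : Space d → Space d → ℝ} {m M : ℝ} [IsFiniteMeasure (volume.restrict S)]
    (h : IsBlockKernel Ω S a m M) {x x' : Space d → ℝ} (hx : Integrable x (volume.restrict Ω))
    (hx' : Integrable x' (volume.restrict Ω)) :
    eLpNorm (fun s => fredholm Ω a x s - fredholm Ω a x' s) 1 (volume.restrict S) ≤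
      eLpNorm (fun t => x t - x' t) 1 (volume.restrict Ω) := by
  have hd : Integrable (fun t => x t - x' t) (volume.restrict Ω) := hx.sub hx'
  have hA : Integrable (fun s => fredholm Ω a x s - fredholm Ω a x' s) (volume.restrict S) :=
    (h.integrable_fredholm hx).sub (h.integrable_fredholm hx')
  rw [eLpNorm_one_eq_lintegral_enorm, eLpNorm_one_eq_lintegral_enorm,
    ← ofReal_integral_norm_eq_lintegral_enorm hA, ← ofReal_integral_norm_eq_lintegral_enorm hd,
    ← h.integral_fredholm hd.norm]
  refine ENNReal.ofReal_le_ofReal (integral_mono_ae hA.norm (h.integrable_fredholm hd.norm) ?_)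
  filter_upwards [h.ae_row, h.integrable_row_mul hx, h.integrable_row_mul hx'] with s hs h1 h2
  rw [fredholm, fredholm, ← integral_sub h1 h2]
  refine (norm_integral_le_integral_norm _).trans (le_of_eq ?_)
  refine integral_congr_ae ?_
  filter_upwards [hs.2] with t hb
  rw [← mul_sub, norm_mul, Real.norm_of_nonneg (h.pos.le.trans hb.1)]

/-! ### The cyclic iteration -/

theorem isFiniteMeasure_restrict_of_isBounded {d : ℕ} {D : Set (Space d)}
    (hD : Bornology.IsBounded D) : IsFiniteMeasure (volume.restrict D) :=
  ⟨by rw [Measure.restrict_apply_univ]; exact hD.measure_lt_top⟩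

theorem IsDensity.congr {d : ℕ} {D : Set (Space d)} {x x' : Space d → ℝ} (hx : IsDensity D x)
    (h : x =ᵐ[volume.restrict D] x') : IsDensity D x' := by
  refine ⟨hx.1.congr h, ?_, (integral_congr_ae h).symm.trans hx.2.2⟩
  filter_upwards [hx.2.1, h] with t h0 e
  rwa [← e]

theorem fredholm_congr {d : ℕ} {Ω : Set (Space d)} (a : Space d → Space d → ℝ)
    {x x' : Space d → ℝ} (h : x =ᵐ[volume.restrict Ω] x') : fredholm Ω a x = fredholm Ω a x' := by
  ext s
  refine integral_congr_ae ?_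
  filter_upwards [h] with t ht
  rw [ht]

theorem blockIndex_add_mul {N : ℕ} [NeZero N] (j : Fin N) (n : ℕ) :
    blockIndex N (j + n * N) = j := by
  ext
  simp [blockIndex, Nat.mod_eq_of_lt j.2]

theorem exists_blockIndex_add_eq {N : ℕ} [NeZero N] (j : Fin N) (k : ℕ) :
    ∃ i < N, blockIndex N (k + i) = j := by
  have hN := Nat.pos_of_ne_zero (NeZero.ne N)
  have hr := Nat.mod_lt k hN
  have hk := Nat.mod_add_div k N
  have hj := j.2
  refine ⟨(j + (N - k % N)) % N, Nat.mod_lt _ hN, Fin.ext ?_⟩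
  change (k + (j + (N - k % N)) % N) % N = j
  rw [Nat.add_mod_mod, show k + (j + (N - k % N)) = j + N + N * (k / N) by omega,
    Nat.add_mul_mod_self_left, Nat.add_mod_right, Nat.mod_eq_of_lt hj]

/-- If the consecutive differences tend to zero in `L¹`, so do the differences over any fixed
number of steps. -/
theorem tendsto_eLpNorm_sub_shift {α : Type*} [MeasurableSpace α] {μ : Measure α}
    {x : ℕ → α → ℝ} (hx : ∀ k, AEStronglyMeasurable (x k) μ)
    (h : Tendsto (fun k => eLpNorm (fun t => x (k + 1) t - x k t) 1 μ) atTop (𝓝 0)) (i : ℕ) :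
    Tendsto (fun k => eLpNorm (fun t => x k t - x (k + i) t) 1 μ) atTop (𝓝 0) := by
  induction i with
  | zero => simp
  | succ i ih =>
    have h1 := ih.add (h.comp (tendsto_add_atTop_nat i))
    rw [add_zero] at h1
    refine tendsto_of_tendsto_of_tendsto_of_le_of_le tendsto_const_nhds h1 (fun _ => zero_le)
      fun k => ?_
    refine le_trans (le_of_eq ?_) ((eLpNorm_sub_le ((hx k).sub (hx (k + i)))
      ((hx (k + i + 1)).sub (hx (k + i))) le_rfl))
    congr 1
    ext t
    simp only [Pi.sub_apply, ← add_assoc]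
    ring

end OSEM

theorem mainTheorem1 {d N : ℕ} [NeZero N]
    (Ω : Set (OSEM.Space d)) (hΩ : IsOpen Ω) (hΩb : Bornology.IsBounded Ω)
    (S : Fin N → Set (OSEM.Space d)) (hS : ∀ j, MeasurableSet (S j))
    (hSb : ∀ j, Bornology.IsBounded (S j))
    (a : Fin N → OSEM.Space d → OSEM.Space d → ℝ) (y : Fin N → OSEM.Space d → ℝ)
    (hA1 : OSEM.AssumptionA1 Ω S a) (hA2 : OSEM.AssumptionA2 Ω S a)
    (hA3 : OSEM.AssumptionA3 S y)
    (x : ℕ → OSEM.Space d → ℝ) (hx : OSEM.IsOSEMSequence Ω S a y x) :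
    -- (i)
    (∀ k : ℕ,
      OSEM.residual Ω (S (OSEM.blockIndex N k)) (a (OSEM.blockIndex N k))
          (y (OSEM.blockIndex N k)) (x (k + 1)) ≤
        OSEM.residual Ω (S (OSEM.blockIndex N k)) (a (OSEM.blockIndex N k))
          (y (OSEM.blockIndex N k)) (x k)) ∧
    ∀ xs : OSEM.Space d → ℝ, OSEM.AssumptionA4 Ω S a y (x 0) xs →
      -- (ii)
      Antitone (fun k : ℕ => OSEM.klDist Ω xs (x k)) ∧
      -- (iii)
      Tendsto (fun k : ℕ => OSEM.residual Ω (S (OSEM.blockIndex N k)) (a (OSEM.blockIndex N k))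
        (y (OSEM.blockIndex N k)) (x k)) atTop (𝓝 0) ∧
      -- (iv)
      Tendsto (fun k : ℕ => OSEM.klDist Ω (x (k + 1)) (x k)) atTop (𝓝 0) ∧
      -- (v)
      (∀ (j : Fin N) (p : ℝ≥0∞), 1 ≤ p → p ≠ ∞ →
        Tendsto (fun n : ℕ =>
          eLpNorm (fun s => OSEM.fredholm Ω (a j) (x ((j : ℕ) + n * N)) s - y j s) p
            (volume.restrict (S j))) atTop (𝓝 0)) ∧
      -- (vi)
      (∀ p : ℝ≥0∞, 1 < p → p ≠ ∞ → OSEM.BoundedInLp Ω p x →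
        ∃ (φ : ℕ → ℕ) (z : OSEM.Space d → ℝ), StrictMono φ ∧
          OSEM.TendstoWeaklyLp Ω p (fun i => x (φ i)) z ∧ OSEM.IsSolution Ω S a y z) := by
  open OSEM in
  have hΩf : IsFiniteMeasure (volume.restrict Ω) := isFiniteMeasure_restrict_of_isBounded hΩb
  have hSf : ∀ j, IsFiniteMeasure (volume.restrict (S j)) := fun j =>
    isFiniteMeasure_restrict_of_isBounded (hSb j)
  obtain ⟨m, M, hm, hM, hb⟩ := hA2
  have hK : ∀ j, IsBlockKernel Ω (S j) (a j) m M := fun j =>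
    ⟨hm, hM, (hA1 j).1, hb j, (hA1 j).2⟩
  obtain ⟨hy, -⟩ := hA3
  obtain ⟨hx0, hstep⟩ := hx
  have hd : ∀ k, IsDensity Ω (x k) := by
    intro k
    induction k with
    | zero => exact hx0
    | succ k ih => exact ((hK _).isDensity_emStep ih (hy _)).congr (hstep k).symm
  -- The residual of the active block decreases at least by the distance of the iterates.
  have hres : ∀ k, klDist Ω (x (k + 1)) (x k) +
      residual Ω (S (blockIndex N k)) (a (blockIndex N k)) (y (blockIndex N k)) (x (k + 1)) ≤
        residual Ω (S (blockIndex N k)) (a (blockIndex N k)) (y (blockIndex N k)) (x k) := by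
    intro k
    rw [OSEM.residual, klDist_congr (hstep k) (ae_eq_refl (x k)), fredholm_congr _ (hstep k)]
    exact (hK _).residual_emStep_add_le (hd k) (hy _)
  refine ⟨fun k => le_add_self.trans (hres k), fun xs hxs => ?_⟩
  obtain ⟨⟨hxsi, hsol⟩, hxs0, -, hfin⟩ := hxs
  -- A nonnegative solution has mass one, since the operators preserve mass.
  have hxsd : IsDensity Ω xs := by
    refine ⟨hxsi, hxs0, ?_⟩
    rw [← (hK 0).integral_fredholm hxsi, integral_congr_ae (hsol 0), (hy 0).2.2]
  have hdec : ∀ k, residual Ω (S (blockIndex N k)) (a (blockIndex N k)) (y (blockIndex N k))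
      (x k) + klDist Ω xs (x (k + 1)) ≤ klDist Ω xs (x k) := by
    intro k
    rw [klDist_congr (ae_eq_refl xs) (hstep k)]
    exact (hK _).residual_add_klDist_emStep_le (hd k) (hy _) hxsd (hsol _)
  have hiii : Tendsto (fun k : ℕ => residual Ω (S (blockIndex N k)) (a (blockIndex N k))
      (y (blockIndex N k)) (x k)) atTop (𝓝 0) := by
    refine ENNReal.tendsto_atTop_zero_of_tsum_ne_top (ne_top_of_le_ne_top hfin.ne ?_)
    refine ENNReal.tsum_le_of_sum_range_le fun n => ?_
    suffices h : ∑ k ∈ Finset.range n, residual Ω (S (blockIndex N k)) (a (blockIndex N k))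
        (y (blockIndex N k)) (x k) + klDist Ω xs (x n) ≤ klDist Ω xs (x 0) from
      le_self_add.trans h
    induction n with
    | zero => simp
    | succ n ih =>
      rw [Finset.sum_range_succ, add_assoc]
      exact (add_le_add_right (hdec n) _).trans ih
  have hiv : Tendsto (fun k : ℕ => klDist Ω (x (k + 1)) (x k)) atTop (𝓝 0) :=
    tendsto_of_tendsto_of_tendsto_of_le_of_le tendsto_const_nhds hiii (fun _ => zero_le)
      fun k => le_self_add.trans (hres k)
  have hG := tendsto_eLpNorm_one_sub (fun k => hy (blockIndex N k))
    (fun k => (hK (blockIndex N k)).isDensity_fredholm (hd k)) hiii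
  refine ⟨antitone_nat_of_succ_le fun k => le_add_self.trans (hdec k), hiii, hiv, ?_, ?_⟩
  · intro j p hp1 hp
    refine tendsto_eLpNorm_of_bounded (B := M.toNNReal) (fun n => ?_) hp1 hp ?_
    -- Both functions are images of densities, hence take values in `[m, M]`.
    · filter_upwards [(hK j).fredholm_bounds (hd (j + n * N)), (hK j).fredholm_bounds hxsd,
        hsol j] with s h1 h2 h3
      rw [h3] at h2
      rw [Real.enorm_eq_ofReal_abs]
      exact ENNReal.ofReal_le_ofReal (abs_sub_le_iff.2 ⟨by linarith, by linarith⟩)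
    · have hN := Nat.pos_of_ne_zero (NeZero.ne N)
      have hlim : Tendsto (fun n : ℕ => (j : ℕ) + n * N) atTop atTop :=
        tendsto_atTop_mono (fun n => (Nat.le_mul_of_pos_right n hN).trans (Nat.le_add_left _ _))
          tendsto_id
      refine (hG.comp hlim).congr fun n => ?_
      simp only [Function.comp_apply, blockIndex_add_mul]
      exact eLpNorm_sub_comm (y j) (fredholm Ω (a j) (x (j + n * N))) 1 _
  · intro p hp1 hp hbd
    obtain ⟨C, hC⟩ := hbd
    have hpq : p.HolderConjugate p.conjExponent := ENNReal.HolderConjugate.conjExponent hp1.le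
    have hq : p.conjExponent ≠ ∞ :=
      (ENNReal.HolderConjugate.ne_top_iff_ne_one p.conjExponent p).2 hp1.ne'
    obtain ⟨φ, z, hφ, hz, hw⟩ := exists_subseq_tendsto_integral_mul hp hq hC
    refine ⟨φ, z, hφ, ⟨fun i => (hC (φ i)).1, hz, fun q hpq' g hg => ?_⟩,
      hz.integrable hp1.le, fun j => ?_⟩
    · obtain rfl := ENNReal.HolderConjugate.unique p p.conjExponent q
      exact hw g hg
    -- Along the whole sequence `A_j x_k → y_j` in `L¹`: within `N` steps the iteration returns to
    -- block `j`, and the iterates change by little meanwhile.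
    have hE : Tendsto (fun k => eLpNorm (fredholm Ω (a j) (x k) - y j) 1 (volume.restrict (S j)))
        atTop (𝓝 0) := by
      have hdiff := tendsto_eLpNorm_sub_shift (fun k => (hd k).1.aestronglyMeasurable)
        (tendsto_eLpNorm_one_sub (fun k => hd (k + 1)) hd hiv)
      have hsum := tendsto_finsetSum (Finset.range N) fun i _ =>
        (hdiff i).add (hG.comp (tendsto_add_atTop_nat i))
      simp only [add_zero, Finset.sum_const_zero] at hsum
      refine tendsto_of_tendsto_of_tendsto_of_le_of_le tendsto_const_nhds hsum (fun _ => zero_le)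
        fun k => ?_
      obtain ⟨i, hi, hij⟩ := exists_blockIndex_add_eq j k
      refine le_trans ?_ (Finset.single_le_sum (f := fun i =>
        eLpNorm (fun t => x k t - x (k + i) t) 1 (volume.restrict Ω) +
        eLpNorm (fun s => y (blockIndex N (k + i)) s -
          fredholm Ω (a (blockIndex N (k + i))) (x (k + i)) s) 1
          (volume.restrict (S (blockIndex N (k + i))))) (fun _ _ => zero_le)
        (Finset.mem_range.2 hi))
      simp only [hij]
      have hA := fun k => ((hK j).integrable_fredholm (hd k).1).aestronglyMeasurable
      have hym := (hy j).1.aestronglyMeasurable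
      have e : fredholm Ω (a j) (x k) - y j = (fredholm Ω (a j) (x k) -
          fredholm Ω (a j) (x (k + i))) - (y j - fredholm Ω (a j) (x (k + i))) := by abel
      rw [e]
      exact (eLpNorm_sub_le ((hA k).sub (hA (k + i))) (hym.sub (hA (k + i))) le_rfl).trans
        (add_le_add_left ((hK j).eLpNorm_fredholm_sub_le (hd k).1 (hd (k + i)).1) _)
    have hmeas := fun k => ((hK j).integrable_fredholm (hd k).1).aestronglyMeasurable
    have h1 : TendstoInMeasure (volume.restrict (S j)) (fun i => fredholm Ω (a j) (x (φ i))) atTop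
        (y j) :=
      tendstoInMeasure_of_tendsto_eLpNorm one_ne_zero (fun i => hmeas (φ i))
        (hy j).1.aestronglyMeasurable (hE.comp hφ.tendsto_atTop)
    have h2 : TendstoInMeasure (volume.restrict (S j)) (fun i => fredholm Ω (a j) (x (φ i))) atTop
        (fredholm Ω (a j) z) := by
      -- Almost every row of the kernel is bounded, hence a test function for the weak convergence.
      refine tendstoInMeasure_of_tendsto_ae (fun i => hmeas (φ i)) ?_
      filter_upwards [(hK j).ae_row] with s hs
      have hrow : MemLp (a j s) p.conjExponent (volume.restrict Ω) :=
        MemLp.of_bound hs.1 M (hs.2.mono fun _ hb => norm_le_of_mem_Icc hm hb)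
      simpa only [fredholm, mul_comm] using hw (a j s) hrow
    exact tendstoInMeasure_ae_unique h2 h1
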